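/- **Setting.** Let $N\ge 1$ clients hold local datasets $\mathcal D_1,\dots,\mathcal D_N$ (client $i$ has $n_i$ samples in a set $\mathcal X$), let $\ell(\mathbf w,d)$ be a real-valued loss of a model $\mathbf w\in\mathbb R^m$ on a sample $d$, and let $C,B,\sigma>0$ and $0<p\le 1$ be constants that do not depend on the data values (in particular one may take $B=p\,n_i$, the expected batch size, when all $n_i$ are equal). Fix the current model $\mathbf w$. One round of the protocol is as follows. 1. *Poisson sampling.* Client $i$ forms a batch $\mathcal B_i\subseteq\mathcal D_i$ by including each of its samples independently with probability $p$. 2. *Clipping.* It computes $\bar{\mathbf g}_i=\frac1B\sum_{d\in\mathcal B_i}\nabla\ell(\mathbf w,d)\big/\max\{1,\|\nabla\ell(\mathbf w,d)\|_2/C\}$. 3. *Dithered quantization.* For every $j\in\{1,\dots,m\}$, client $i$ and the parameter server (PS) share $V_{i,j}\sim\Gamma(3/2,1/2)$ (shape, rate) and, with $\Delta_{i,j}=2\sigma\sqrt{V_{i,j}}$, a dither $U_{i,j}$ which given $V_{i,j}$ is uniform on $(-\Delta_{i,j}/2,\Delta_{i,j}/2)$; the pairs $(V_{i,j},U_{i,j})$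 are independent over all $i,j$ and independent of the batches. The client sends $Q_{\Delta_{i,j}}\big((\bar{\mathbf g}_i)_j+U_{i,j}\big)$, where $Q_\Delta(x)=\Delta\cdot\mathrm{round}\big(\frac{x-\Delta/2}{\Delta}\big)+\frac\Delta2$, and the PS forms $(\hat{\mathbf g}_i)_j=Q_{\Delta_{i,j}}\big((\bar{\mathbf g}_i)_j+U_{i,j}\big)-U_{i,j}$. 4. *Averaging.* The PS releases $\mathbf g=\frac1N\sum_{i=1}^N\hat{\mathbf g}_i$. A randomized algorithm $\mathcal M$ is $(\varepsilon,\delta)$-DP, where $\varepsilon>0$ and $\delta\in[0,1)$, if $\Pr[\mathcal M(\mathcal D)\in O]\le e^{\varepsilon}\Pr[\mathcal M(\mathcal D')\in O]+\delta$ for all measurable $O$ and all adjacent $\mathcal D,\mathcal D'$. At sample level, $(\mathcal D_i)_i$ and $(\mathcal D_i')_i$ are adjacent if they differ in the value of only one sample of one client. **Theorem.** (a) For all datasets, $$\mathbf g=\frac1N\sum_{i=1}^N\bar{\mathbf g}_i+\mathbf Z,\qquad \mathbf Z\sim\mathcal N\Big(0,\frac{\sigma^2}{N}\mathbf I_m\Big),$$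 with $\mathbf Z$ independent of the batches; here the law of $\mathbf Z$ is its unconditional law, i.e. the one seen by an observer who does not know the shared random variables $V_{i,j},U_{i,j}$. (b) Consequently, for every $\varepsilon'>0$, the map from the datasets to the released $\mathbf g$ is $(\varepsilon,\delta)$-DP at sample level, with $$\varepsilon=\log\big(1+p(e^{\varepsilon'}-1)\big),$$ $$\delta=p\,\Phi\Big(\frac{C}{\sigma B\sqrt N}-\frac{\varepsilon'\sigma B\sqrt N}{2C}\Big)-p\,e^{\varepsilon'}\,\Phi\Big(-\frac{C}{\sigma B\sqrt N}-\frac{\varepsilon'\sigma B\sqrt N}{2C}\Big),$$ where $\Phi$ is the distribution function of the standard normal law. -/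

import Mathlib

open MeasureTheory ProbabilityTheory

noncomputable section

namespace DitheredFL

/-! ### Differential privacy -/

/-- The randomized algorithm `M`, which on input `D` outputs the random variable `M D` on the
probability space `(Ω, P)`, is `(ε, δ)`-differentially private with respect to the adjacency
relation `Adj` on inputs. -/
def IsDP {Ω 𝒟 Y : Type*} [MeasurableSpace Ω] [MeasurableSpace Y] (P : Measure Ω)
    (Adj : 𝒟 → 𝒟 → Prop) (M : 𝒟 → Ω → Y) (ε δ : ℝ) : Prop :=
  0 < ε ∧ 0 ≤ δ ∧ δ < 1 ∧
    ∀ D D' : 𝒟, Adj D D' → ∀ O : Set Y, MeasurableSet O →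
      P.real {ω | M D ω ∈ O} ≤ Real.exp ε * P.real {ω | M D' ω ∈ O} + δ

/-! ### Data, batches and local gradients -/

/-- The local datasets of `N` clients: client `i` holds `n i` samples. -/
abbrev Datasets {N : ℕ} (n : Fin N → ℕ) (𝒳 : Type*) : Type _ :=
  (i : Fin N) → Fin (n i) → 𝒳

/-- Sample-level adjacency: all samples agree, except possibly the `k`-th one of one client `i`. -/
def SampleAdjacent {N : ℕ} {n : Fin N → ℕ} {𝒳 : Type*} (D D' : Datasets n 𝒳) : Prop :=
  ∃ (i : Fin N) (k : Fin (n i)), (∀ k' ≠ k, D i k' = D' i k') ∧ ∀ i' ≠ i, D i' = D' i'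

/-- A choice of batches: sample `k` of client `i` is in the batch of client `i` iff
`b i k = true`. -/
abbrev Batches {N : ℕ} (n : Fin N → ℕ) : Type :=
  (i : Fin N) → Fin (n i) → Bool

/-- Poisson sampling: every sample is put in the batch independently with probability `p`. -/
def poissonSampling {N : ℕ} (n : Fin N → ℕ) (p : unitInterval) : Measure (Batches n) :=
  Measure.pi fun _ ↦ Measure.pi fun _ ↦ bernoulliMeasure true false p

/-- Clipping to Euclidean norm at most `C`. -/
def clip {m : ℕ} (C : ℝ) (x : EuclideanSpace ℝ (Fin m)) : EuclideanSpace ℝ (Fin m) :=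
  (max 1 (‖x‖ / C))⁻¹ • x

/-- The local gradient of one client with data `d` and batch `b`, for the loss `ℓ` at the
model `w`: the sum over the batch of the clipped sample gradients, divided by `B`. -/
def localGradient {m n : ℕ} {𝒳 : Type*} (ℓ : EuclideanSpace ℝ (Fin m) → 𝒳 → ℝ)
    (w : EuclideanSpace ℝ (Fin m)) (C B : ℝ) (d : Fin n → 𝒳) (b : Fin n → Bool) :
    EuclideanSpace ℝ (Fin m) :=
  B⁻¹ • ∑ k with b k = true, clip C (gradient (fun w' ↦ ℓ w' (d k)) w)

/-! ### Subtractive dithering with a random step size -/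

/-- The quantization step size `Δ = 2 σ √v`. -/
def stepSize (σ v : ℝ) : ℝ := 2 * σ * √v

/-- The quantizer with step size `Δ`, whose representation points are
`…, -3Δ/2, -Δ/2, Δ/2, 3Δ/2, …`. -/
def quantize (Δ x : ℝ) : ℝ := (round ((x - Δ / 2) / Δ) : ℝ) * Δ + Δ / 2

/-- The conditional law of the dither given `V = v`: uniform on `[-Δ/2, Δ/2]`, where
`Δ = 2 σ √v`. (For `Δ ≤ 0`, which has probability zero under the law of `V` if `σ > 0`,
this is the zero measure.) -/
def ditherKernel (σ : ℝ) : Kernel ℝ ℝ where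
  toFun v := ProbabilityTheory.cond volume (Set.Icc (-(stepSize σ v / 2)) (stepSize σ v / 2))
  measurable' := by
    have hs : Measurable fun v : ℝ ↦ stepSize σ v := by unfold stepSize; fun_prop
    refine Measure.measurable_of_measurable_coe _ fun s h ↦ ?_
    simp only [ProbabilityTheory.cond, Measure.smul_apply, smul_eq_mul]
    refine Measurable.mul ?_ ?_
    · simp only [Real.volume_Icc]
      fun_prop
    · simp only [Measure.restrict_apply h]
      have hset : MeasurableSet {q : ℝ × ℝ |
          q.2 ∈ s ∧ -(stepSize σ q.1 / 2) ≤ q.2 ∧ q.2 ≤ stepSize σ q.1 / 2} :=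
        (measurable_snd h).inter
          ((measurableSet_le (by fun_prop) measurable_snd).inter
            (measurableSet_le measurable_snd (by fun_prop)))
      exact measurable_measure_prodMk_left hset

/-- The conditional law is a subprobability, so that the joint law below is well defined. -/
instance instIsFiniteKernelDitherKernel (σ : ℝ) : IsFiniteKernel (ditherKernel σ) where
  exists_univ_le := by
    refine ⟨1, ENNReal.one_lt_top, fun v ↦ ?_⟩
    change ProbabilityTheory.cond volume _ Set.univ ≤ 1
    exact prob_le_one

/-- The joint law of the pair `(V, U)` that a client and the server share for one coordinate:
`V ∼ Γ(3/2, 1/2)` (shape, rate), and `U` is uniform on `[-Δ/2, Δ/2]` given `V`. -/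
def sharedLaw (σ : ℝ) : Measure (ℝ × ℝ) :=
  gammaMeasure (3 / 2) (1 / 2) ⊗ₘ ditherKernel σ

/-- The server's reconstruction `Q(yⱼ + Uⱼ) - Uⱼ` of a client's vector `y`, where `r j = (Vⱼ, Uⱼ)`
is the shared randomness. -/
def estimate {m : ℕ} (σ : ℝ) (y : EuclideanSpace ℝ (Fin m)) (r : Fin m → ℝ × ℝ) :
    EuclideanSpace ℝ (Fin m) :=
  WithLp.toLp 2 fun j ↦ quantize (stepSize σ (r j).1) (y j + (r j).2) - (r j).2

/-! ### One round of the protocol -/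

/-- All the randomness of a round: the batches, and the pairs `(V i j, U i j)` for client `i` and
coordinate `j`. -/
abbrev Randomness {N : ℕ} (n : Fin N → ℕ) (m : ℕ) : Type :=
  Batches n × (Fin N → Fin m → ℝ × ℝ)

/-- The law of the randomness: Poisson sampling, and independently of it independent pairs
`(V i j, U i j)` over all clients and coordinates. -/
def roundLaw {N : ℕ} (n : Fin N → ℕ) (m : ℕ) (p : unitInterval) (σ : ℝ) :
    Measure (Randomness n m) :=
  (poissonSampling n p).prod (Measure.pi fun _ ↦ Measure.pi fun _ ↦ sharedLaw σ)

/-- The average over the clients of the exact local gradients. -/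
def exactAverage {N m : ℕ} {n : Fin N → ℕ} {𝒳 : Type*}
    (ℓ : EuclideanSpace ℝ (Fin m) → 𝒳 → ℝ) (w : EuclideanSpace ℝ (Fin m)) (C B : ℝ)
    (D : Datasets n 𝒳) (ω : Randomness n m) : EuclideanSpace ℝ (Fin m) :=
  (N : ℝ)⁻¹ • ∑ i, localGradient ℓ w C B (D i) (ω.1 i)

/-- The global gradient average computed by the server: the average over the clients of the
reconstructed local gradients. -/
def globalAverage {N m : ℕ} {n : Fin N → ℕ} {𝒳 : Type*}
    (ℓ : EuclideanSpace ℝ (Fin m) → 𝒳 → ℝ) (w : EuclideanSpace ℝ (Fin m)) (C B σ : ℝ)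
    (D : Datasets n 𝒳) (ω : Randomness n m) : EuclideanSpace ℝ (Fin m) :=
  (N : ℝ)⁻¹ • ∑ i, estimate σ (localGradient ℓ w C B (D i) (ω.1 i)) (ω.2 i)

/-- The distribution function of the standard normal distribution. -/
def stdNormalCDF (x : ℝ) : ℝ := cdf (gaussianReal 0 1) x

end DitheredFL

end

open scoped ENNReal NNReal

/-! For a fixed step size Δ, the error of subtractive dithering is a Δ-periodic sawtooth in `y + u`,
so a dither uniform over one period makes it uniform on a period, whatever `y` is. With Δ = 2σ√V and
V ∼ Γ(3/2, 1/2), the mixture of the uniform laws on [-σ√V, σ√V] is exactly N(0, σ²)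
(`map_quantizationError_sharedLaw`). This law does not depend on the quantized value, hence not on
the batches; averaging over the clients gives the noise law and its independence
(`map_noise_batches`).

For privacy, the release is therefore a Gaussian mechanism on a Poisson subsample. Splitting the
isotropic noise along the displacement of the mean reduces the comparison of two shifted Gaussians
to N(0, 1) against N(μ, 1), where Neyman–Pearson gives the tight δ (`multivariateGaussian_real_le`).
Conditioning on the inclusion of every sample but the differing one leaves a two-point mixture: if
that sample is excluded, neighbouring data give the same output; if it is included, its law is
compared both with the included neighbour and with the excluded case. Combining these two bounds
(`subsampling_le`) replaces e^ε by 1 + p(e^ε - 1) and δ by pδ. -/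

namespace DitheredFL


/-! ### Quantization error of one coordinate -/

/-- The error of the subtractively dithered quantizer is a sawtooth function of `y + u`. -/
lemma quantize_sub_sub {Δ : ℝ} (hΔ : 0 < Δ) (y u : ℝ) :
    quantize Δ (y + u) - u - y = Δ * (1 / 2 - Int.fract ((y + u) / Δ)) := by
  have h : (y + u - Δ / 2) / Δ + 1 / 2 = (y + u) / Δ := by field_simp; ring
  have hy : Δ * ((y + u) / Δ) = y + u := by field_simp
  rw [quantize, round_eq, h, Int.fract]
  linear_combination hy

lemma measurable_stepSize (σ : ℝ) : Measurable (stepSize σ) := by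
  unfold stepSize; fun_prop

lemma stepSize_pos {σ v : ℝ} (hσ : 0 < σ) (hv : 0 < v) : 0 < stepSize σ v := by
  unfold stepSize; positivity

lemma measurable_quantize {α : Type*} [MeasurableSpace α] {f g : α → ℝ} (hf : Measurable f)
    (hg : Measurable g) : Measurable fun a ↦ quantize (f a) (g a) := by
  simp only [quantize, round_eq]
  have h : Measurable fun a ↦ ⌊(g a - f a / 2) / f a + 1 / 2⌋ := by fun_prop
  have h' : Measurable fun a ↦ ((⌊(g a - f a / 2) / f a + 1 / 2⌋ : ℤ) : ℝ) :=
    (measurable_from_top (f := fun z : ℤ ↦ (z : ℝ))).comp h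
  fun_prop

/-- The uniform law on a period is mapped by the sawtooth function to the uniform law. -/
lemma volume_sawtooth_preimage {Δ : ℝ} (hΔ : 0 < Δ) (y : ℝ) {s : Set ℝ} (hs : MeasurableSet s) :
    volume (Set.Icc (-(Δ / 2)) (Δ / 2) ∩ {u | Δ * (1 / 2 - Int.fract ((y + u) / Δ)) ∈ s})
      = volume (Set.Icc (-(Δ / 2)) (Δ / 2) ∩ s) := by
  set g : ℝ → ℝ := fun t ↦ Δ * (1 / 2 - Int.fract (t / Δ)) with hg
  have hgm : Measurable g := by
    have : Measurable fun t : ℝ ↦ Int.fract (t / Δ) := measurable_fract.comp (by fun_prop)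
    fun_prop
  have hper : ∀ (z : AddSubgroup.zmultiples Δ) (t : ℝ), g (z +ᵥ t) = g t := by
    rintro ⟨z, hz⟩ t
    obtain ⟨k, rfl⟩ := AddSubgroup.mem_zmultiples_iff.mp hz
    have : (k • Δ + t) / Δ = t / Δ + k := by
      rw [zsmul_eq_mul]; field_simp; ring
    simp only [hg, AddSubgroup.mk_vadd, vadd_eq_add, this, Int.fract_add_intCast]
  -- Translating by `y` moves the dither interval to another window of length Δ.
  have hshift : volume (Set.Icc (-(Δ / 2)) (Δ / 2) ∩ {u | g (y + u) ∈ s})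
      = volume (Set.Ioc (y - Δ / 2) (y - Δ / 2 + Δ) ∩ g ⁻¹' s) := by
    have h1 : volume (Set.Icc (-(Δ / 2)) (Δ / 2) ∩ {u | g (y + u) ∈ s})
        = volume (Set.Ioc (-(Δ / 2)) (Δ / 2) ∩ {u | g (y + u) ∈ s}) :=
      measure_congr (Ioc_ae_eq_Icc.symm.inter (ae_eq_refl _))
    rw [h1, ← measure_preimage_add volume y (Set.Ioc (y - Δ / 2) (y - Δ / 2 + Δ) ∩ g ⁻¹' s)]
    congr 1
    ext u
    simp only [Set.mem_inter_iff, Set.mem_Ioc, Set.mem_ofPred_eq, Set.mem_preimage]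
    refine and_congr_left fun _ ↦ ⟨fun h ↦ ⟨?_, ?_⟩, fun h ↦ ⟨?_, ?_⟩⟩ <;> linarith [h.1, h.2]
  -- Any two half-open windows of length Δ are fundamental domains for ℤΔ, so a periodic set has the
  -- same measure in both.
  have hdom : volume (Set.Ioc (y - Δ / 2) (y - Δ / 2 + Δ) ∩ g ⁻¹' s)
      = volume (Set.Ioc 0 (0 + Δ) ∩ g ⁻¹' s) := by
    have h := (isAddFundamentalDomain_Ioc hΔ (y - Δ / 2)).measure_set_eq
      (isAddFundamentalDomain_Ioc hΔ 0) (A := g ⁻¹' s) (hgm hs) (fun z ↦ by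
        ext t
        simp only [Set.mem_preimage]
        rw [hper])
    rw [Set.inter_comm, h, Set.inter_comm]
  -- On [0, Δ) the sawtooth is the reflection t ↦ Δ/2 - t, which preserves Lebesgue measure.
  have hreflect : volume (Set.Ioc 0 (0 + Δ) ∩ g ⁻¹' s)
      = volume (Set.Icc (-(Δ / 2)) (Δ / 2) ∩ s) := by
    have h1 : volume (Set.Ioc 0 (0 + Δ) ∩ g ⁻¹' s) = volume (Set.Ico 0 Δ ∩ g ⁻¹' s) := by
      rw [zero_add]
      exact measure_congr (Ico_ae_eq_Ioc.symm.inter (ae_eq_refl _))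
    have h2 : volume (Set.Icc (-(Δ / 2)) (Δ / 2) ∩ s)
        = volume (Set.Ioc (-(Δ / 2)) (Δ / 2) ∩ s) :=
      measure_congr (Ioc_ae_eq_Icc.symm.inter (ae_eq_refl _))
    have hpres : MeasurePreserving (fun t : ℝ ↦ Δ / 2 - t) volume volume :=
      Measure.measurePreserving_sub_left volume (Δ / 2)
    rw [h1, h2, ← hpres.measure_preimage (measurableSet_Ioc.inter hs).nullMeasurableSet]
    congr 1
    ext t
    simp only [Set.mem_inter_iff, Set.mem_Ico, Set.mem_preimage, Set.mem_Ioc]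
    have hmem : 0 ≤ t ∧ t < Δ ↔ -(Δ / 2) < Δ / 2 - t ∧ Δ / 2 - t ≤ Δ / 2 :=
      ⟨fun h ↦ ⟨by linarith [h.2], by linarith [h.1]⟩,
        fun h ↦ ⟨by linarith [h.2], by linarith [h.1]⟩⟩
    rw [← hmem]
    refine and_congr_right fun h ↦ ?_
    have : Int.fract (t / Δ) = t / Δ :=
      Int.fract_eq_self.2 ⟨div_nonneg h.1 hΔ.le, (div_lt_one hΔ).2 h.2⟩
    have h3 : g t = Δ / 2 - t := by
      simp only [hg, this]; field_simp
    rw [h3]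
  rw [← hreflect, ← hdom, ← hshift]

/-- Given the step size, the quantization error is uniform. -/
lemma ditherKernel_error {σ v : ℝ} (hσ : 0 < σ) (hv : 0 < v) (y : ℝ) {s : Set ℝ}
    (hs : MeasurableSet s) :
    ditherKernel σ v {u | quantize (stepSize σ v) (y + u) - u - y ∈ s} =
      ENNReal.ofReal (stepSize σ v)⁻¹ *
        volume (Set.Icc (-(stepSize σ v / 2)) (stepSize σ v / 2) ∩ s) := by
  have hΔ := stepSize_pos hσ hv
  change ProbabilityTheory.cond volume _ _ = _
  rw [ProbabilityTheory.cond_apply measurableSet_Icc]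
  simp only [quantize_sub_sub hΔ]
  rw [volume_sawtooth_preimage hΔ y hs, Real.volume_Icc, ← ENNReal.ofReal_inv_of_pos (by linarith)]
  congr 3
  ring

lemma lintegral_exp_neg_half_Ioi (c : ℝ) :
    ∫⁻ v in Set.Ioi c, ENNReal.ofReal (Real.exp (-(1 / 2) * v))
      = ENNReal.ofReal (2 * Real.exp (-(1 / 2) * c)) := by
  rw [← ofReal_integral_eq_lintegral_ofReal
    (integrableOn_exp_mul_Ioi (by norm_num) c) (Filter.Eventually.of_forall fun _ ↦ by positivity),
    integral_exp_mul_Ioi (by norm_num)]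
  congr 1
  ring

/-- This is where the shape 3/2 matters: its factor √v cancels the 1/√v of the uniform density,
leaving a pure exponential whose tails are explicit. -/
lemma gammaPDF_mul_inv_stepSize {σ v : ℝ} (hσ : 0 < σ) (hv : 0 < v) :
    gammaPDF (3 / 2) (1 / 2) v * ENNReal.ofReal (stepSize σ v)⁻¹ =
      ENNReal.ofReal (2 * σ * √(2 * Real.pi))⁻¹ * ENNReal.ofReal (Real.exp (-(1 / 2) * v)) := by
  rw [gammaPDF_of_nonneg hv.le, ← ENNReal.ofReal_mul (by positivity),
    ← ENNReal.ofReal_mul (by positivity)]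
  congr 1
  have hG : Real.Gamma (3 / 2) = √Real.pi / 2 := by
    have := Real.Gamma_add_one (s := 1 / 2) (by norm_num)
    rw [Real.Gamma_one_half_eq] at this
    rw [show (3 / 2 : ℝ) = 1 / 2 + 1 by norm_num, this]; ring
  have h2 : ((1 : ℝ) / 2) ^ (3 / 2 : ℝ) = (2 * √2)⁻¹ := by
    rw [show (3 / 2 : ℝ) = 1 + 1 / 2 by norm_num, Real.rpow_add (by norm_num), Real.rpow_one,
      ← Real.sqrt_eq_rpow, one_div, Real.sqrt_inv, mul_inv]
  have hv' : v ^ ((3 / 2 : ℝ) - 1) = √v := by rw [Real.sqrt_eq_rpow]; norm_num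
  have hsv : 0 < √v := Real.sqrt_pos.2 hv
  have hsp : 0 < √Real.pi := Real.sqrt_pos.2 Real.pi_pos
  rw [hG, h2, hv', stepSize, Real.sqrt_mul (by norm_num), show -(1 / 2 * v) = -(1 / 2) * v by ring]
  field_simp

/-- Mixing the uniform laws on `[-σ √v, σ √v]` over `v ∼ Γ(3/2, 1/2)` gives a normal law. -/
lemma lintegral_gamma_uniform {σ : ℝ} (hσ : 0 < σ) {s : Set ℝ} (hs : MeasurableSet s) :
    ∫⁻ v in Set.Ioi 0, gammaPDF (3 / 2) (1 / 2) v * (ENNReal.ofReal (stepSize σ v)⁻¹ *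
        volume (Set.Icc (-(stepSize σ v / 2)) (stepSize σ v / 2) ∩ s))
      = gaussianReal 0 (σ ^ 2).toNNReal s := by
  set c : ℝ≥0∞ := ENNReal.ofReal (2 * σ * √(2 * Real.pi))⁻¹ with hc
  set k : ℝ → ℝ → ℝ≥0∞ := fun v z ↦
    (Set.Icc (-(stepSize σ v / 2)) (stepSize σ v / 2)).indicator
      (fun _ ↦ c * ENNReal.ofReal (Real.exp (-(1 / 2) * v))) z with hk
  have hkm : Measurable (Function.uncurry k) := by
    have hset : MeasurableSet {q : ℝ × ℝ | q.2 ∈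
        Set.Icc (-(stepSize σ q.1 / 2)) (stepSize σ q.1 / 2)} := by
      have := measurable_stepSize σ
      exact (measurableSet_le (by fun_prop) measurable_snd).inter
            (measurableSet_le measurable_snd (by fun_prop))
    have : Function.uncurry k = {q : ℝ × ℝ | q.2 ∈
        Set.Icc (-(stepSize σ q.1 / 2)) (stepSize σ q.1 / 2)}.indicator
        (fun q ↦ c * ENNReal.ofReal (Real.exp (-(1 / 2) * q.1))) := by
      ext ⟨v, z⟩
      simp [hk, Set.indicator]
    rw [this]
    exact Measurable.indicator (by fun_prop) hset
  have h1 : ∀ v ∈ Set.Ioi (0 : ℝ),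
      gammaPDF (3 / 2) (1 / 2) v * (ENNReal.ofReal (stepSize σ v)⁻¹ *
        volume (Set.Icc (-(stepSize σ v / 2)) (stepSize σ v / 2) ∩ s))
      = ∫⁻ z in s, k v z := by
    intro v hv
    rw [← mul_assoc, gammaPDF_mul_inv_stepSize hσ hv, lintegral_indicator measurableSet_Icc,
      setLIntegral_const, Measure.restrict_apply measurableSet_Icc]
  rw [setLIntegral_congr_fun measurableSet_Ioi h1, lintegral_lintegral_swap hkm.aemeasurable,
    gaussianReal_apply 0 (by simpa using hσ.ne')]
  refine setLIntegral_congr_fun hs fun z _ ↦ ?_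
  -- After the swap, z is fixed: |z| ≤ σ√v means v ≥ z²/σ², so the inner integral is an exponential
  -- tail, proportional to exp(-z²/(2σ²)).
  have h2 : ∀ v ∈ Set.Ioi (0 : ℝ), k v z = (Set.Ici (z ^ 2 / σ ^ 2)).indicator
      (fun v ↦ c * ENNReal.ofReal (Real.exp (-(1 / 2) * v))) v := by
    intro v hv
    simp only [hk, Set.indicator, Set.mem_Icc, Set.mem_Ici]
    congr 1
    have e : stepSize σ v / 2 = σ * √v := by rw [stepSize]; ring
    rw [e, ← abs_le, ← div_le_iff₀' hσ, Real.le_sqrt (by positivity), div_pow, sq_abs]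
    exact le_of_lt hv
  have hz : 0 ≤ z ^ 2 / σ ^ 2 := by positivity
  rw [setLIntegral_congr_fun measurableSet_Ioi h2, lintegral_indicator measurableSet_Ici,
    Measure.restrict_restrict measurableSet_Ici]
  have h3 : (Set.Ici (z ^ 2 / σ ^ 2) ∩ Set.Ioi 0 : Set ℝ) =ᵐ[volume] Set.Ioi (z ^ 2 / σ ^ 2) := by
    refine (Ioi_ae_eq_Ici.symm.inter (ae_eq_refl _)).trans (Filter.EventuallyEq.of_eq ?_)
    exact Set.inter_eq_left.2 fun v hv ↦ lt_of_le_of_lt hz hv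
  rw [setLIntegral_congr h3, lintegral_const_mul _ (by fun_prop), lintegral_exp_neg_half_Ioi, hc,
    ← ENNReal.ofReal_mul (by positivity), gaussianPDF, gaussianPDFReal]
  congr 1
  rw [Real.coe_toNNReal _ (by positivity), sub_zero, mul_comm (2 * Real.pi),
    Real.sqrt_mul (sq_nonneg σ), Real.sqrt_sq hσ.le,
    show -z ^ 2 / (2 * σ ^ 2) = -(1 / 2) * (z ^ 2 / σ ^ 2) by ring]
  have : 0 < √(2 * Real.pi) := Real.sqrt_pos.2 (by positivity)
  field_simp

lemma measurable_quantizationError (σ y : ℝ) :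
    Measurable fun r : ℝ × ℝ ↦ quantize (stepSize σ r.1) (y + r.2) - r.2 - y := by
  have h : Measurable fun r : ℝ × ℝ ↦ quantize (stepSize σ r.1) (y + r.2) :=
    measurable_quantize ((measurable_stepSize σ).comp measurable_fst) (measurable_snd.const_add y)
  exact (h.sub measurable_snd).sub measurable_const

/-- Whatever the quantized value, the quantization error is normal. -/
lemma map_quantizationError_sharedLaw {σ : ℝ} (hσ : 0 < σ) (y : ℝ) :
    (sharedLaw σ).map (fun r ↦ quantize (stepSize σ r.1) (y + r.2) - r.2 - y)
      = gaussianReal 0 (σ ^ 2).toNNReal := by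
  have : IsProbabilityMeasure (gammaMeasure (3 / 2) (1 / 2)) :=
    isProbabilityMeasure_gammaMeasure (by norm_num) (by norm_num)
  ext s hs
  have hm := measurable_quantizationError σ y
  rw [Measure.map_apply hm hs, sharedLaw, Measure.compProd_apply (hm hs), gammaMeasure,
    lintegral_withDensity_eq_lintegral_mul _ (by unfold gammaPDF; fun_prop)
      (Kernel.measurable_kernel_prodMk_left (hm hs)), ← lintegral_gamma_uniform hσ hs]
  rw [← lintegral_indicator measurableSet_Ioi]
  -- The gamma density vanishes for v < 0, and the degenerate step size at v = 0 is a null event.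
  have h0 : ∀ᵐ v : ℝ, v ≠ 0 := by simp [ae_iff]
  refine lintegral_congr_ae (h0.mono fun v hv ↦ ?_)
  rcases lt_or_gt_of_ne hv with hv | hv
  · simp [gammaPDF_of_neg hv, hv.le]
  · rw [Set.indicator_of_mem (by exact hv), ← ditherKernel_error hσ hv y hs]
    rfl

/-- `ditherKernel` is only a subprobability kernel by construction; total mass 1 is read off from
the normal pushforward. -/
lemma isProbabilityMeasure_sharedLaw {σ : ℝ} (hσ : 0 < σ) :
    IsProbabilityMeasure (sharedLaw σ) := by
  have h : IsProbabilityMeasure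
      ((sharedLaw σ).map (fun r ↦ quantize (stepSize σ r.1) (0 + r.2) - r.2 - 0)) := by
    rw [map_quantizationError_sharedLaw hσ]; infer_instance
  exact Measure.isProbabilityMeasure_of_map
    (fun r ↦ quantize (stepSize σ r.1) (0 + r.2) - r.2 - 0)

/-! ### The Gaussian mechanism -/

section GaussianMechanism


/-- The likelihood ratio is monotone in `x` for fixed μ, so the optimal tests are half-lines. -/
lemma gaussianPDFReal_shift (μ x : ℝ) :
    gaussianPDFReal μ 1 x = Real.exp (μ * x - μ ^ 2 / 2) * gaussianPDFReal 0 1 x := by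
  simp only [gaussianPDFReal, NNReal.coe_one]
  rw [mul_left_comm, ← Real.exp_add]
  congr 2
  ring

lemma gaussianReal_real_apply (μ : ℝ) (A : Set ℝ) :
    (gaussianReal μ 1).real A = ∫ x in A, gaussianPDFReal μ 1 x := by
  rw [measureReal_def, gaussianReal_apply_eq_integral μ one_ne_zero,
    ENNReal.toReal_ofReal (integral_nonneg fun x ↦ gaussianPDFReal_nonneg _ _ _)]

/-- The tight `δ` of the Gaussian mechanism with sensitivity-to-noise ratio `μ`. -/
noncomputable def gaussianDelta (ε μ : ℝ) : ℝ :=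
  stdNormalCDF (μ / 2 - ε / μ) - Real.exp ε * stdNormalCDF (-(μ / 2) - ε / μ)

lemma gaussianReal_real_Iic (μ t : ℝ) :
    (gaussianReal μ 1).real (Set.Iic t) = stdNormalCDF (t - μ) := by
  have h := gaussianReal_map_add_const (μ := 0) (v := 1) μ
  rw [zero_add] at h
  rw [stdNormalCDF, cdf_eq_real, ← h, map_measureReal_apply (by fun_prop) measurableSet_Iic]
  congr 1
  ext x
  simp [le_sub_iff_add_le]

/-- The Neyman–Pearson bound for two normal laws with the same variance. -/
lemma gaussianReal_real_le {μ : ℝ} (hμ : 0 < μ) (ε : ℝ) {A : Set ℝ} (hA : MeasurableSet A) :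
    (gaussianReal 0 1).real A ≤
      Real.exp ε * (gaussianReal μ 1).real A + gaussianDelta ε μ := by
  -- The threshold where the density of N(0, 1) equals e^ε times that of N(μ, 1).
  set t := μ / 2 - ε / μ with ht
  have hmul : μ * (ε / μ) = ε := by field_simp
  have hle : ∀ x, x ≤ t → Real.exp ε * gaussianPDFReal μ 1 x ≤ gaussianPDFReal 0 1 x := by
    intro x hx
    rw [gaussianPDFReal_shift, ← mul_assoc, ← Real.exp_add]
    refine mul_le_of_le_one_left (gaussianPDFReal_nonneg _ _ _) (Real.exp_le_one_iff.2 ?_)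
    nlinarith [mul_le_mul_of_nonneg_left hx hμ.le]
  have hge : ∀ x, t < x → gaussianPDFReal 0 1 x ≤ Real.exp ε * gaussianPDFReal μ 1 x := by
    intro x hx
    rw [gaussianPDFReal_shift μ, ← mul_assoc, ← Real.exp_add]
    refine le_mul_of_one_le_left (gaussianPDFReal_nonneg _ _ _) (Real.one_le_exp ?_)
    nlinarith [mul_lt_mul_of_pos_left hx hμ]
  have hint : ∀ (ν : ℝ) (S : Set ℝ), IntegrableOn (gaussianPDFReal ν 1) S := fun ν S ↦
    (integrable_gaussianPDFReal ν 1).integrableOn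
  -- Passing from `A` to the half-line drops points where the weighted difference of densities is
  -- nonpositive and adds points where it is nonnegative, so the half-line maximizes it.
  have h1 : (gaussianReal 0 1).real (A \ Set.Iic t)
      ≤ Real.exp ε * (gaussianReal μ 1).real (A \ Set.Iic t) := by
    have hS : MeasurableSet (A \ Set.Iic t) := hA.diff measurableSet_Iic
    rw [gaussianReal_real_apply, gaussianReal_real_apply, ← integral_const_mul]
    exact setIntegral_mono_on (hint _ _) ((hint _ _).const_mul _) hS
      fun x hx ↦ hge x (not_le.1 hx.2)
  have h2 : Real.exp ε * (gaussianReal μ 1).real (Set.Iic t \ A)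
      ≤ (gaussianReal 0 1).real (Set.Iic t \ A) := by
    have hS : MeasurableSet (Set.Iic t \ A) := measurableSet_Iic.diff hA
    rw [gaussianReal_real_apply, gaussianReal_real_apply, ← integral_const_mul]
    exact setIntegral_mono_on ((hint _ _).const_mul _) (hint _ _) hS fun x hx ↦ hle x hx.1
  have hδ : gaussianDelta ε μ = (gaussianReal 0 1).real (Set.Iic t)
      - Real.exp ε * (gaussianReal μ 1).real (Set.Iic t) := by
    rw [gaussianReal_real_Iic, gaussianReal_real_Iic, gaussianDelta, sub_zero,
      show t - μ = -(μ / 2) - ε / μ by rw [ht]; ring]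
  have e1 := measureReal_inter_add_sdiff (μ := gaussianReal 0 1) (s := A) (t := Set.Iic t) measurableSet_Iic
  have e2 := measureReal_inter_add_sdiff (μ := gaussianReal μ 1) (s := A) (t := Set.Iic t) measurableSet_Iic
  have e3 := measureReal_inter_add_sdiff (μ := gaussianReal 0 1) (s := Set.Iic t) (t := A) hA
  have e4 := measureReal_inter_add_sdiff (μ := gaussianReal μ 1) (s := Set.Iic t) (t := A) hA
  rw [Set.inter_comm] at e3 e4
  rw [hδ, ← e1, ← e2, ← e3, ← e4]
  linarith

lemma gaussianDelta_nonneg {μ : ℝ} (hμ : 0 < μ) (ε : ℝ) : 0 ≤ gaussianDelta ε μ := by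
  simpa using gaussianReal_real_le hμ ε MeasurableSet.empty

lemma gaussianDelta_lt_one (ε μ : ℝ) : gaussianDelta ε μ < 1 := by
  have h1 : stdNormalCDF (μ / 2 - ε / μ) ≤ 1 := cdf_le_one _ _
  have h2 : 0 < stdNormalCDF (-(μ / 2) - ε / μ) := by
    rw [← sub_zero (-(μ / 2) - ε / μ), ← gaussianReal_real_Iic, measureReal_def]
    refine ENNReal.toReal_pos (fun h ↦ ?_) (measure_ne_top _ _)
    have := gaussianReal_absolutelyContinuous' 0 one_ne_zero h
    simp at this
  have := mul_pos (Real.exp_pos ε) h2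
  rw [gaussianDelta]
  linarith

variable {m : ℕ}

lemma posSemidef_smul_one {a : ℝ} (ha : 0 ≤ a) :
    (a • (1 : Matrix (Fin m) (Fin m) ℝ)).PosSemidef :=
  Matrix.PosSemidef.one.smul ha

/-- An isotropic normal law with covariance `a` dominates the normal law on a line. -/
lemma posSemidef_smul_one_sub_vecMulVec {a : ℝ} (u : EuclideanSpace ℝ (Fin m))
    (hu : ‖u‖ ^ 2 ≤ a) :
    (a • (1 : Matrix (Fin m) (Fin m) ℝ) - Matrix.vecMulVec u u).PosSemidef := by
  refine Matrix.PosSemidef.of_dotProduct_mulVec_nonneg ?_ fun x ↦ ?_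
  · ext i j
    simp [Matrix.vecMulVec_apply, Matrix.one_apply, mul_comm, eq_comm]
  -- Cauchy–Schwarz: ⟨x, u⟩² ≤ ‖x‖² ‖u‖² ≤ a ‖x‖².
  · have hcs := real_inner_mul_inner_self_le (WithLp.toLp 2 x) u
    have hx : (inner ℝ (WithLp.toLp 2 x) u : ℝ) = x ⬝ᵥ u := by
      simp [PiLp.inner_apply, dotProduct, mul_comm]
    have hxx : (inner ℝ (WithLp.toLp 2 x) (WithLp.toLp 2 x) : ℝ) = x ⬝ᵥ x := by
      rw [real_inner_self_eq_norm_sq, EuclideanSpace.real_norm_sq_eq]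
      simp [dotProduct, sq]
    rw [hxx, hx, real_inner_self_eq_norm_sq] at hcs
    have h0 : 0 ≤ x ⬝ᵥ x := by simpa using dotProduct_star_self_nonneg x
    simp only [star_trivial, Matrix.sub_mulVec, Matrix.smul_mulVec, Matrix.one_mulVec,
      dotProduct_sub, dotProduct_smul, Matrix.vecMulVec_mulVec, smul_eq_mul]
    have : (u : Fin m → ℝ) ⬝ᵥ x = x ⬝ᵥ u := dotProduct_comm _ _
    simp [this]
    nlinarith [mul_le_mul_of_nonneg_left hu h0]

/-- An isotropic normal law splits off an independent normal component along a line. -/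
lemma map_prod_eq_multivariateGaussian {a : ℝ} (u : EuclideanSpace ℝ (Fin m))
    (hu : ‖u‖ ^ 2 ≤ a) :
    ((gaussianReal 0 1).prod (multivariateGaussian 0
        (a • (1 : Matrix (Fin m) (Fin m) ℝ) - Matrix.vecMulVec u u))).map
      (fun q ↦ q.1 • u + q.2) = multivariateGaussian 0 (a • (1 : Matrix (Fin m) (Fin m) ℝ)) := by
  have ha : 0 ≤ a := (sq_nonneg _).trans hu
  -- The characteristic function factors; the exponents -⟨u, t⟩²/2 and -(a‖t‖² - ⟨u, t⟩²)/2 add up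
  -- to the isotropic one.
  apply Measure.ext_of_charFun
  ext t
  rw [charFun_multivariateGaussian (posSemidef_smul_one ha), charFun_apply,
    integral_map (Measurable.aemeasurable (by fun_prop))
    (Measurable.aestronglyMeasurable (by fun_prop))]
  simp only [inner_add_left, real_inner_smul_left, Complex.ofReal_add, add_mul, Complex.exp_add]
  rw [integral_prod_mul (f := fun x : ℝ ↦ Complex.exp (((x * inner ℝ u t : ℝ) : ℂ) * Complex.I))
    (g := fun y : EuclideanSpace ℝ (Fin m) ↦ Complex.exp (((inner ℝ y t : ℝ) : ℂ) * Complex.I)),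
    ← charFun_apply, charFun_multivariateGaussian (posSemidef_smul_one_sub_vecMulVec u hu)]
  simp_rw [mul_comm _ (inner ℝ u t : ℝ), Complex.ofReal_mul]
  rw [← charFun_apply_real, charFun_gaussianReal, ← Complex.exp_add]
  congr 1
  have hut : (inner ℝ u t : ℝ) = t.ofLp ⬝ᵥ u.ofLp := by
    simp [PiLp.inner_apply, dotProduct]
  simp only [Matrix.sub_mulVec, Matrix.vecMulVec_mulVec, dotProduct_sub, hut,
    dotProduct_comm u.ofLp t.ofLp]
  simp
  ring

/-- The Gaussian mechanism on a Euclidean space. -/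
lemma multivariateGaussian_real_le {μ τ : ℝ} (hμ : 0 < μ) (ε : ℝ)
    {x y : EuclideanSpace ℝ (Fin m)} (hxy : ‖y - x‖ ≤ τ * μ)
    {O : Set (EuclideanSpace ℝ (Fin m))} (hO : MeasurableSet O) :
    (multivariateGaussian 0 (τ ^ 2 • (1 : Matrix (Fin m) (Fin m) ℝ))).real {z | z + x ∈ O} ≤
      Real.exp ε * (multivariateGaussian 0 (τ ^ 2 • (1 : Matrix (Fin m) (Fin m) ℝ))).real
        {z | z + y ∈ O} + gaussianDelta ε μ := by
  -- With this scaling, replacing `x` by `y` shifts the standard normal coefficient of `u` by μ,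
  -- while ‖u‖ ≤ τ keeps the residual covariance positive semidefinite. For each fixed residual `w`
  -- the one-dimensional bound applies.
  set u := μ⁻¹ • (y - x) with hu
  have hyu : y = x + μ • u := by rw [hu, smul_inv_smul₀ hμ.ne']; abel
  have hu2 : ‖u‖ ^ 2 ≤ τ ^ 2 := by
    refine pow_le_pow_left₀ (norm_nonneg _) ?_ 2
    rw [hu, norm_smul, norm_inv, Real.norm_of_nonneg hμ.le, inv_mul_le_iff₀ hμ, mul_comm]
    exact hxy
  set W := multivariateGaussian 0 (τ ^ 2 • (1 : Matrix (Fin m) (Fin m) ℝ) - Matrix.vecMulVec u u)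
  have hsplit : ∀ c : EuclideanSpace ℝ (Fin m),
      (multivariateGaussian 0 (τ ^ 2 • (1 : Matrix (Fin m) (Fin m) ℝ))).real {z | z + c ∈ O}
        = ∫ w, (gaussianReal 0 1).real {s | s • u + w + c ∈ O} ∂W := by
    intro c
    have hS : MeasurableSet {z | z + c ∈ O} := (measurable_add_const c) hO
    have hm : Measurable fun q : ℝ × EuclideanSpace ℝ (Fin m) ↦ q.1 • u + q.2 := by fun_prop
    rw [← map_prod_eq_multivariateGaussian u hu2, map_measureReal_apply hm hS, measureReal_def,
      Measure.prod_apply_symm (hm hS),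
      integral_eq_lintegral_of_nonneg_ae (f := fun w ↦ (gaussianReal 0 1).real {s | s • u + w + c ∈ O})
        (Filter.Eventually.of_forall fun _ ↦ measureReal_nonneg)
        (measurable_measure_prodMk_right (hm hS)).ennreal_toReal.aestronglyMeasurable]
    congr 1
    refine lintegral_congr fun w ↦ ?_
    rw [ofReal_measureReal]
    rfl
  have hint : ∀ c : EuclideanSpace ℝ (Fin m),
      Integrable (fun w ↦ (gaussianReal 0 1).real {s | s • u + w + c ∈ O}) W := by
    intro c
    have hm : Measurable fun q : ℝ × EuclideanSpace ℝ (Fin m) ↦ q.1 • u + q.2 + c := by fun_prop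
    refine Integrable.of_bound
      (measurable_measure_prodMk_right (hm hO)).ennreal_toReal.aestronglyMeasurable 1
      (Filter.Eventually.of_forall fun w ↦ ?_)
    rw [Real.norm_of_nonneg measureReal_nonneg]
    exact measureReal_le_one
  rw [hsplit, hsplit, ← integral_const_mul]
  have hconst : gaussianDelta ε μ = ∫ _, gaussianDelta ε μ ∂W := by simp
  rw [hconst, ← integral_add ((hint y).const_mul _) (integrable_const _)]
  refine integral_mono (hint x) (((hint y).const_mul _).add (integrable_const _)) fun w ↦ ?_
  have hA : MeasurableSet {s : ℝ | s • u + w + x ∈ O} :=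
    (by fun_prop : Measurable fun s : ℝ ↦ s • u + w + x) hO
  have h := gaussianReal_map_add_const (μ := 0) (v := 1) μ
  rw [zero_add] at h
  have key := gaussianReal_real_le hμ ε hA
  rw [← h, map_measureReal_apply (by fun_prop) hA] at key
  have hset : {s : ℝ | s • u + w + y ∈ O} = (fun s ↦ s + μ) ⁻¹' {s | s • u + w + x ∈ O} := by
    ext s
    have : s • u + w + y = (s + μ) • u + w + x := by rw [hyu, add_smul]; abel
    change s • u + w + y ∈ O ↔ (s + μ) • u + w + x ∈ O
    rw [this]
  simpa only [← hset] using key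

end GaussianMechanism


/-! ### Averaged noise and its independence of the batches -/

/-- The average of `N` independent isotropic normal vectors. -/
lemma map_average_pi_gaussianReal {N m : ℕ} (hN : 0 < N) (v : ℝ≥0) :
    (Measure.pi fun _ : Fin N ↦ Measure.pi fun _ : Fin m ↦ gaussianReal 0 v).map
      (fun e ↦ (N : ℝ)⁻¹ • ∑ i, WithLp.toLp 2 (e i)) =
    multivariateGaussian 0 (((v : ℝ) / (N : ℝ)) • (1 : Matrix (Fin m) (Fin m) ℝ)) := by
  have hN' : (N : ℂ) ≠ 0 := by exact_mod_cast hN.ne'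
  have hmeas : Measurable fun e : Fin N → Fin m → ℝ ↦ (N : ℝ)⁻¹ • ∑ i, WithLp.toLp 2 (e i) := by
    fun_prop
  have : IsProbabilityMeasure
      ((Measure.pi fun _ : Fin N ↦ Measure.pi fun _ : Fin m ↦ gaussianReal 0 v).map
        (fun e ↦ (N : ℝ)⁻¹ • ∑ i, WithLp.toLp 2 (e i))) :=
    Measure.isProbabilityMeasure_map hmeas.aemeasurable
  apply Measure.ext_of_charFun
  ext t
  rw [charFun_multivariateGaussian (posSemidef_smul_one (by positivity)), charFun_apply,
    integral_map hmeas.aemeasurable (Measurable.aestronglyMeasurable (by fun_prop))]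
  have hinner : ∀ e : Fin N → Fin m → ℝ,
      (inner ℝ ((N : ℝ)⁻¹ • ∑ i, WithLp.toLp 2 (e i)) t : ℝ)
        = ∑ i, inner ℝ (WithLp.toLp 2 (e i)) ((N : ℝ)⁻¹ • t) := fun e ↦ by
    rw [real_inner_smul_left, ← real_inner_smul_right, sum_inner]
  simp only [hinner, Complex.ofReal_sum, Finset.sum_mul, Complex.exp_sum]
  rw [integral_fintype_prod_eq_prod (f := fun (_ : Fin N) (x : Fin m → ℝ) ↦
    Complex.exp (((inner ℝ (WithLp.toLp 2 x) ((N : ℝ)⁻¹ • t) : ℝ) : ℂ) * Complex.I))]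
  have h1 : ∫ x : Fin m → ℝ,
      Complex.exp (((inner ℝ (WithLp.toLp 2 x) ((N : ℝ)⁻¹ • t) : ℝ) : ℂ) * Complex.I)
        ∂(Measure.pi fun _ ↦ gaussianReal 0 v)
      = charFun ((Measure.pi fun _ : Fin m ↦ gaussianReal 0 v).map (WithLp.toLp 2))
          ((N : ℝ)⁻¹ • t) := by
    rw [charFun_apply, integral_map (Measurable.aemeasurable (by fun_prop))
      (Measurable.aestronglyMeasurable (by fun_prop))]
  rw [Finset.prod_congr rfl fun _ _ ↦ h1, charFun_pi]
  -- Each of the `N` clients contributes the exponent -v‖t‖²/(2N²), for a total of -v‖t‖²/(2N).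
  simp only [charFun_gaussianReal, ← Complex.exp_sum, Finset.prod_const, ← Complex.exp_nat_mul]
  congr 1
  simp only [Finset.card_univ, Fintype.card_fin, Matrix.smul_mulVec, Matrix.one_mulVec,
    dotProduct, Finset.mul_sum]
  simp only [PiLp.smul_apply, Pi.smul_apply, smul_eq_mul, Complex.ofReal_mul, Complex.ofReal_inv,
    Complex.ofReal_natCast, Complex.ofReal_zero, mul_zero, zero_mul, zero_sub, inner_zero_right,
    Complex.ofReal_sum, Complex.ofReal_div, Finset.sum_div, ← Finset.sum_neg_distrib]
  refine Finset.sum_congr rfl fun j _ ↦ ?_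
  field_simp

/-- The total quantization noise, for given local vectors `y`. -/
noncomputable def averagedError {N m : ℕ} (σ : ℝ) (y : Fin N → EuclideanSpace ℝ (Fin m))
    (r : Fin N → Fin m → ℝ × ℝ) : EuclideanSpace ℝ (Fin m) :=
  (N : ℝ)⁻¹ • ∑ i, estimate σ (y i) (r i) - (N : ℝ)⁻¹ • ∑ i, y i

lemma averagedError_eq {N m : ℕ} (σ : ℝ) (y : Fin N → EuclideanSpace ℝ (Fin m))
    (r : Fin N → Fin m → ℝ × ℝ) :
    averagedError σ y r = (N : ℝ)⁻¹ • ∑ i, WithLp.toLp 2 fun j ↦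
      quantize (stepSize σ (r i j).1) (y i j + (r i j).2) - (r i j).2 - y i j := by
  rw [averagedError, ← smul_sub, ← Finset.sum_sub_distrib]
  rfl

lemma measurable_quantizationErrors {N m : ℕ} (σ : ℝ) (y : Fin N → EuclideanSpace ℝ (Fin m)) :
    Measurable fun (r : Fin N → Fin m → ℝ × ℝ) (i : Fin N) (j : Fin m) ↦
      quantize (stepSize σ (r i j).1) (y i j + (r i j).2) - (r i j).2 - y i j :=
  measurable_pi_lambda _ fun i ↦ measurable_pi_lambda _ fun j ↦
    (measurable_quantizationError σ (y i j)).comp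
      ((measurable_pi_apply j).comp (measurable_pi_apply i))

lemma measurable_averagedError {N m : ℕ} (σ : ℝ) (y : Fin N → EuclideanSpace ℝ (Fin m)) :
    Measurable (averagedError σ y) := by
  have h : Measurable fun e : Fin N → Fin m → ℝ ↦ (N : ℝ)⁻¹ • ∑ i, WithLp.toLp 2 (e i) := by
    fun_prop
  rw [show averagedError σ y = _ from funext (averagedError_eq σ y)]
  exact h.comp (measurable_quantizationErrors σ y)

/-- The law of the total quantization noise does not depend on the local vectors. -/
lemma map_averagedError {N m : ℕ} (hN : 0 < N) {σ : ℝ} (hσ : 0 < σ)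
    (y : Fin N → EuclideanSpace ℝ (Fin m)) :
    (Measure.pi fun _ ↦ Measure.pi fun _ ↦ sharedLaw σ).map (averagedError σ y) =
      multivariateGaussian 0 ((σ ^ 2 / (N : ℝ)) • (1 : Matrix (Fin m) (Fin m) ℝ)) := by
  have := isProbabilityMeasure_sharedLaw hσ
  have h : Measurable fun e : Fin N → Fin m → ℝ ↦ (N : ℝ)⁻¹ • ∑ i, WithLp.toLp 2 (e i) := by
    fun_prop
  have hm : ∀ i : Fin N, Measurable fun (x : Fin m → ℝ × ℝ) (j : Fin m) ↦
      quantize (stepSize σ (x j).1) (y i j + (x j).2) - (x j).2 - y i j := fun i ↦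
    measurable_pi_lambda _ fun j ↦
      (measurable_quantizationError σ (y i j)).comp (measurable_pi_apply j)
  have hrow : ∀ i : Fin N, (Measure.pi fun _ : Fin m ↦ sharedLaw σ).map
      (fun x j ↦ quantize (stepSize σ (x j).1) (y i j + (x j).2) - (x j).2 - y i j)
      = Measure.pi fun _ : Fin m ↦ gaussianReal 0 (σ ^ 2).toNNReal := by
    intro i
    have hfin : ∀ j : Fin m, IsProbabilityMeasure ((sharedLaw σ).map
        fun r ↦ quantize (stepSize σ r.1) (y i j + r.2) - r.2 - y i j) := fun j ↦
      Measure.isProbabilityMeasure_map (measurable_quantizationError σ (y i j)).aemeasurable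
    rw [Measure.pi_map_pi (f := fun j (r : ℝ × ℝ) ↦
      quantize (stepSize σ r.1) (y i j + r.2) - r.2 - y i j)
      fun j ↦ (measurable_quantizationError σ (y i j)).aemeasurable]
    simp only [map_quantizationError_sharedLaw hσ]
  have hall : (Measure.pi fun _ : Fin N ↦ Measure.pi fun _ : Fin m ↦ sharedLaw σ).map
      (fun r i j ↦ quantize (stepSize σ (r i j).1) (y i j + (r i j).2) - (r i j).2 - y i j)
      = Measure.pi fun _ : Fin N ↦ Measure.pi fun _ : Fin m ↦
        gaussianReal 0 (σ ^ 2).toNNReal := by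
    have hfin : ∀ i : Fin N, IsProbabilityMeasure ((Measure.pi fun _ : Fin m ↦ sharedLaw σ).map
        (fun x j ↦ quantize (stepSize σ (x j).1) (y i j + (x j).2) - (x j).2 - y i j)) :=
      fun i ↦ Measure.isProbabilityMeasure_map (hm i).aemeasurable
    rw [Measure.pi_map_pi (f := fun i (x : Fin m → ℝ × ℝ) (j : Fin m) ↦
      quantize (stepSize σ (x j).1) (y i j + (x j).2) - (x j).2 - y i j)
      fun i ↦ (hm i).aemeasurable]
    simp only [hrow]
  rw [show averagedError σ y = _ from funext (averagedError_eq σ y),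
    ← Real.coe_toNNReal (σ ^ 2) (sq_nonneg σ), ← map_average_pi_gaussianReal hN, ← hall,
    Measure.map_map h (measurable_quantizationErrors σ y)]
  rfl

/-- If the conditional law of `f b` does not depend on `b`, then `f` is independent of `b`. -/
lemma map_prod_of_forall_map_eq {α β γ : Type*} [MeasurableSpace α] [MeasurableSpace β]
    [MeasurableSpace γ] {μ : Measure α} {η : Measure β} {ν : Measure γ} [SigmaFinite μ]
    [SFinite η] [SigmaFinite ν] {f : α × β → γ} (hf : Measurable f)
    (h : ∀ a, η.map (fun b ↦ f (a, b)) = ν) :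
    (μ.prod η).map (fun q ↦ (f q, q.1)) = ν.prod μ := by
  refine (Measure.prod_eq fun s t hs ht ↦ ?_).symm
  have hm : Measurable fun q : α × β ↦ (f q, q.1) := hf.prodMk measurable_fst
  rw [Measure.map_apply hm (hs.prod ht), Measure.prod_apply (hm (hs.prod ht))]
  have : ∀ a, η (Prod.mk a ⁻¹' ((fun q : α × β ↦ (f q, q.1)) ⁻¹' s ×ˢ t))
      = t.indicator (fun _ ↦ ν s) a := by
    intro a
    by_cases ha : a ∈ t
    · rw [Set.indicator_of_mem ha, ← h a,
        Measure.map_apply (by fun_prop) hs]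
      congr 1
      ext b
      simp [ha]
    · have : Prod.mk a ⁻¹' ((fun q : α × β ↦ (f q, q.1)) ⁻¹' s ×ˢ t) = ∅ := by
        ext b
        simp [ha]
      rw [this, Set.indicator_of_notMem ha, measure_empty]
  simp only [this]
  rw [lintegral_indicator_const ht]


/-! ### Conditioning the Poisson sampling on one sample -/

/-- Resampling one coordinate preserves a product of probability measures. -/
lemma measurePreserving_update {ι : Type*} [Fintype ι] [DecidableEq ι] {X : ι → Type*}
    [∀ i, MeasurableSpace (X i)] (μ : ∀ i, Measure (X i)) [∀ i, IsProbabilityMeasure (μ i)]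
    (k : ι) :
    MeasurePreserving (fun q : (∀ i, X i) × X k ↦ Function.update q.1 k q.2)
      ((Measure.pi μ).prod (μ k)) (Measure.pi μ) := by
  have hm : Measurable fun q : (∀ i, X i) × X k ↦ Function.update q.1 k q.2 := by
    refine measurable_pi_lambda _ fun i ↦ ?_
    by_cases h : i = k
    · subst h
      simpa using measurable_snd
    · simp only [Function.update_of_ne h]
      exact (measurable_pi_apply i).comp measurable_fst
  refine ⟨hm, (Measure.pi_eq fun s hs ↦ ?_).symm⟩
  -- The old value at `k` is discarded, so that factor of the box is unconstrained and has mass 1.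
  have hpre : (fun q : (∀ i, X i) × X k ↦ Function.update q.1 k q.2) ⁻¹' Set.univ.pi s
      = (Set.univ.pi (Function.update s k Set.univ)) ×ˢ s k := by
    ext ⟨x, c⟩
    simp only [Set.mem_preimage, Set.mem_pi, Set.mem_univ, true_imp_iff, Set.mem_prod]
    constructor
    · refine fun h ↦ ⟨fun i ↦ ?_, by simpa using h k⟩
      by_cases hi : i = k
      · subst hi; simp
      · simpa [hi] using h i
    · rintro ⟨h, hc⟩ i
      by_cases hi : i = k
      · subst hi; simpa using hc
      · simpa [hi] using h i
  rw [Measure.map_apply hm (.univ_pi hs), hpre, Measure.prod_prod, Measure.pi_pi,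
    ← Finset.prod_erase_mul _ _ (Finset.mem_univ k),
    ← Finset.prod_erase_mul _ (fun i ↦ μ i (s i)) (Finset.mem_univ k)]
  simp only [Function.update_self, measure_univ, mul_one]
  congr 1
  refine Finset.prod_congr rfl fun i hi ↦ ?_
  rw [Function.update_of_ne (Finset.ne_of_mem_erase hi)]

lemma integral_pi_update {ι : Type*} [Fintype ι] [DecidableEq ι] {X : ι → Type*}
    [∀ i, MeasurableSpace (X i)] [∀ i, Finite (X i)] [∀ i, MeasurableSingletonClass (X i)]
    (μ : ∀ i, Measure (X i)) [∀ i, IsProbabilityMeasure (μ i)] (k : ι) (F : (∀ i, X i) → ℝ) :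
    ∫ x, F x ∂Measure.pi μ = ∫ x, ∫ c, F (Function.update x k c) ∂μ k ∂Measure.pi μ := by
  have h := measurePreserving_update μ k
  rw [← integral_prod (fun q : (∀ i, X i) × X k ↦ F (Function.update q.1 k q.2)) .of_finite]
  nth_rewrite 1 [← h.map_eq]
  exact integral_map h.measurable.aemeasurable (measurable_of_finite F).aestronglyMeasurable

/-- The batches `b`, but with sample `k` of client `i` included according to `c`. -/
def setSample {N : ℕ} {n : Fin N → ℕ} (b : Batches n) (i : Fin N) (k : Fin (n i)) (c : Bool) :
    Batches n :=
  Function.update b i (Function.update (b i) k c)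

lemma integral_bernoulliMeasure_bool (p : unitInterval) (f : Bool → ℝ) :
    ∫ c, f c ∂bernoulliMeasure true false p = p * f true + (1 - p) * f false := by
  rw [integral_bernoulliMeasure]
  simp

/-- Conditioning on whether a given sample is in its batch. -/
lemma integral_poissonSampling {N : ℕ} {n : Fin N → ℕ} (p : unitInterval) (i : Fin N)
    (k : Fin (n i)) (F : Batches n → ℝ) :
    ∫ b, F b ∂poissonSampling n p =
      ∫ b, (p * F (setSample b i k true) + (1 - p) * F (setSample b i k false))
        ∂poissonSampling n p := by
  have hL : ∀ b : Batches n, p * F (setSample b i k true) + (1 - p) * F (setSample b i k false)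
      = ∫ c, F (setSample b i k c) ∂bernoulliMeasure true false p := fun b ↦
    (integral_bernoulliMeasure_bool p fun c ↦ F (setSample b i k c)).symm
  simp only [hL]
  unfold poissonSampling
  -- The product has two levels: the row of client `i` is resampled first, then entry `k` within
  -- that row.
  rw [integral_pi_update _ i F, integral_pi_update _ i fun b : Batches n ↦
    ∫ c, F (setSample b i k c) ∂bernoulliMeasure true false p]
  refine integral_congr_ae (Filter.Eventually.of_forall fun b ↦ ?_)
  dsimp only
  rw [integral_pi_update _ k]
  simp [setSample]

/-! ### Clipping and the sensitivity of the average gradient -/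

lemma norm_clip_le {m : ℕ} {C : ℝ} (hC : 0 < C) (x : EuclideanSpace ℝ (Fin m)) :
    ‖clip C x‖ ≤ C := by
  have h : 0 < max 1 (‖x‖ / C) := lt_max_of_lt_left one_pos
  rw [clip, norm_smul, norm_inv, Real.norm_of_nonneg h.le, inv_mul_le_iff₀ h, ← div_le_iff₀ hC]
  exact le_max_right _ _

section Gradients

variable {m : ℕ} {𝒳 : Type*} (ℓ : EuclideanSpace ℝ (Fin m) → 𝒳 → ℝ)
  (w : EuclideanSpace ℝ (Fin m)) (C B : ℝ)

lemma localGradient_update_true {n : ℕ} (d : Fin n → 𝒳) (b : Fin n → Bool) (k : Fin n) :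
    localGradient ℓ w C B d (Function.update b k true) =
      localGradient ℓ w C B d (Function.update b k false)
        + B⁻¹ • clip C (gradient (fun w' ↦ ℓ w' (d k)) w) := by
  have h : (Finset.univ.filter fun k' ↦ Function.update b k true k' = true)
      = insert k (Finset.univ.filter fun k' ↦ Function.update b k false k' = true) := by
    ext k'
    by_cases hk : k' = k
    · subst hk; simp
    · simp [hk]
  rw [localGradient, localGradient, h, Finset.sum_insert (by simp), smul_add, add_comm]

lemma localGradient_update_false_congr {n : ℕ} {d d' : Fin n → 𝒳} {k : Fin n}
    (hd : ∀ k' ≠ k, d k' = d' k') (b : Fin n → Bool) :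
    localGradient ℓ w C B d (Function.update b k false) =
      localGradient ℓ w C B d' (Function.update b k false) := by
  rw [localGradient, localGradient]
  congr 1
  refine Finset.sum_congr rfl fun k' hk' ↦ ?_
  have hne : k' ≠ k := by
    rintro rfl
    simp at hk'
  rw [hd k' hne]

/-- The average of the local gradients as a function of the batches. -/
noncomputable def batchAverage {N : ℕ} {n : Fin N → ℕ} (D : Datasets n 𝒳) (b : Batches n) :
    EuclideanSpace ℝ (Fin m) :=
  (N : ℝ)⁻¹ • ∑ i, localGradient ℓ w C B (D i) (b i)

/-- Isolates the only term through which the differing sample acts; clipping then bounds its effect.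
-/
lemma batchAverage_setSample_true {N : ℕ} {n : Fin N → ℕ} (D : Datasets n 𝒳) (b : Batches n)
    (i : Fin N) (k : Fin (n i)) :
    batchAverage ℓ w C B D (setSample b i k true) =
      batchAverage ℓ w C B D (setSample b i k false)
        + (N : ℝ)⁻¹ • B⁻¹ • clip C (gradient (fun w' ↦ ℓ w' (D i k)) w) := by
  rw [batchAverage, batchAverage, ← smul_add]
  congr 1
  rw [← sub_eq_iff_eq_add', ← Finset.sum_sub_distrib, Finset.sum_eq_single i]
  · simp only [setSample, Function.update_self]
    rw [localGradient_update_true, add_sub_cancel_left]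
  · intro i' _ hi'
    simp [setSample, hi']
  · simp

lemma batchAverage_setSample_false_congr {N : ℕ} {n : Fin N → ℕ} {D D' : Datasets n 𝒳}
    {i : Fin N} {k : Fin (n i)} (hk : ∀ k' ≠ k, D i k' = D' i k') (hi : ∀ i' ≠ i, D i' = D' i')
    (b : Batches n) :
    batchAverage ℓ w C B D (setSample b i k false) =
      batchAverage ℓ w C B D' (setSample b i k false) := by
  rw [batchAverage, batchAverage]
  congr 1
  refine Finset.sum_congr rfl fun i' _ ↦ ?_
  by_cases h : i' = i
  · subst h
    simp only [setSample, Function.update_self]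
    exact localGradient_update_false_congr ℓ w C B hk _
  · rw [hi i' h]

/-! ### Amplification by subsampling and privacy of the round -/

variable {C B}

/-- Privacy amplification by subsampling, at fixed batches of the other samples: `F` and `F'` are
the probabilities of an event for neighbouring data, and the index tells whether the differing
sample is in its batch. -/
lemma subsampling_le {p e δ F₁ F₁' F₀ : ℝ} (hp : 0 ≤ p) (hp1 : p ≤ 1) (he : 1 ≤ e)
    (h₁ : F₁ ≤ e * F₁' + δ) (h₀ : F₁ ≤ e * F₀ + δ) :
    p * F₁ + (1 - p) * F₀ ≤ (1 + p * (e - 1)) * (p * F₁' + (1 - p) * F₀) + p * δ := by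
  set α := 1 + p * (e - 1) with hα
  have hα0 : 0 ≤ α := by nlinarith
  have hαe : α ≤ e := by nlinarith
  have he0 : 0 < e := by linarith
  -- The two bounds on `F₁` are weighted by α and e - α, which sum to e. Since e - α = (1 - p)(e -
  -- 1), the resulting coefficient of `F₀` is exactly α(1 - p).
  have h : e * F₁ ≤ α * (e * F₁' + δ) + (e - α) * (e * F₀ + δ) := by
    have h2 := mul_le_mul_of_nonneg_left h₁ hα0
    have h3 := mul_le_mul_of_nonneg_left h₀ (sub_nonneg.2 hαe)
    linarith
  have h' : F₁ ≤ α * F₁' + (e - α) * F₀ + δ := by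
    refine le_of_mul_le_mul_left (h.trans_eq ?_) he0
    ring
  have h4 := mul_le_mul_of_nonneg_left h' hp
  have h5 : (1 - p) * F₀ + p * (e - α) * F₀ = α * (1 - p) * F₀ := by rw [hα]; ring
  linarith

variable {N : ℕ} {n : Fin N → ℕ}

instance instIsProbabilityMeasurePoissonSampling (p : unitInterval) :
    IsProbabilityMeasure (poissonSampling n p) := by
  unfold poissonSampling; infer_instance

variable {σ : ℝ} (p : unitInterval)

/-- There are finitely many batches, so measurability in the shared randomness at each fixed batch
suffices. -/
lemma measurable_globalAverage_sub_exactAverage (σ : ℝ) (D : Datasets n 𝒳) :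
    Measurable fun ω : Randomness n m ↦
      globalAverage ℓ w C B σ D ω - exactAverage ℓ w C B D ω :=
  measurable_from_prod_countable_right fun b ↦
    measurable_averagedError σ fun i ↦ localGradient ℓ w C B (D i) (b i)

/-- The joint law of the noise and the batches. -/
lemma map_noise_batches (hN : 0 < N) (hσ : 0 < σ) (D : Datasets n 𝒳) :
    (roundLaw n m p σ).map (fun ω ↦
      (globalAverage ℓ w C B σ D ω - exactAverage ℓ w C B D ω, ω.1)) =
    (multivariateGaussian 0 ((σ ^ 2 / (N : ℝ)) • (1 : Matrix (Fin m) (Fin m) ℝ))).prod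
      (poissonSampling n p) := by
  have := isProbabilityMeasure_sharedLaw hσ
  exact map_prod_of_forall_map_eq (measurable_globalAverage_sub_exactAverage ℓ w σ D)
    fun b ↦ map_averagedError hN hσ fun i ↦ localGradient ℓ w C B (D i) (b i)

/-- The released vector is the exact average plus Gaussian noise. -/
lemma roundLaw_real_globalAverage (hN : 0 < N) (hσ : 0 < σ) (D : Datasets n 𝒳)
    {O : Set (EuclideanSpace ℝ (Fin m))} (hO : MeasurableSet O) :
    (roundLaw n m p σ).real {ω | globalAverage ℓ w C B σ D ω ∈ O} =
      ∫ b, (multivariateGaussian 0 ((σ ^ 2 / (N : ℝ)) • (1 : Matrix (Fin m) (Fin m) ℝ))).real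
        {z | z + batchAverage ℓ w C B D b ∈ O} ∂poissonSampling n p := by
  have hnoise : Measurable fun ω : Randomness n m ↦
      (globalAverage ℓ w C B σ D ω - exactAverage ℓ w C B D ω, ω.1) :=
    (measurable_globalAverage_sub_exactAverage ℓ w σ D).prodMk measurable_fst
  have hadd : Measurable fun q : EuclideanSpace ℝ (Fin m) × Batches n ↦
      q.1 + batchAverage ℓ w C B D q.2 :=
    measurable_fst.add ((measurable_of_finite (batchAverage ℓ w C B D)).comp measurable_snd)
  have hset : {ω : Randomness n m | globalAverage ℓ w C B σ D ω ∈ O} =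
      (fun ω : Randomness n m ↦
        (globalAverage ℓ w C B σ D ω - exactAverage ℓ w C B D ω, ω.1)) ⁻¹'
      ((fun q : EuclideanSpace ℝ (Fin m) × Batches n ↦
        q.1 + batchAverage ℓ w C B D q.2) ⁻¹' O) := by
    ext ω
    change _ ↔ globalAverage ℓ w C B σ D ω - exactAverage ℓ w C B D ω
      + exactAverage ℓ w C B D ω ∈ O
    rw [sub_add_cancel]
    rfl
  rw [hset, ← map_measureReal_apply hnoise (hadd hO), map_noise_batches ℓ w p hN hσ D,
    measureReal_def, Measure.prod_apply_symm (hadd hO), integral_eq_lintegral_of_nonneg_ae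
      (Filter.Eventually.of_forall fun _ ↦ measureReal_nonneg)
      (measurable_of_finite _).aestronglyMeasurable]
  congr 1
  refine lintegral_congr fun b ↦ ?_
  rw [ofReal_measureReal]
  rfl

/-- Replacing an included sample moves the average by at most 2C/(NB), and the noise has standard
deviation σ/√N per coordinate; their ratio is the parameter of `gaussianDelta`. -/
lemma isDP_globalAverage (hN : 0 < N) (hC : 0 < C) (hB : 0 < B) (hσ : 0 < σ) (hp : 0 < p)
    {ε : ℝ} (hε : 0 < ε) :
    IsDP (roundLaw n m p σ) SampleAdjacent
      (fun D : Datasets n 𝒳 ↦ globalAverage ℓ w C B σ D)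
      (Real.log (1 + (p : ℝ) * (Real.exp ε - 1)))
      (p * gaussianDelta ε (2 * C / (σ * B * √(N : ℝ)))) := by
  have hN' : (0 : ℝ) < N := by exact_mod_cast hN
  have hsN : 0 < √(N : ℝ) := Real.sqrt_pos.2 hN'
  have hp0 : (0 : ℝ) < p := hp
  have hp1 : (p : ℝ) ≤ 1 := p.2.2
  have he : 1 < Real.exp ε := Real.one_lt_exp_iff.2 hε
  have hα : 1 < 1 + (p : ℝ) * (Real.exp ε - 1) := by
    have := mul_pos hp0 (sub_pos.2 he)
    linarith
  set μ := 2 * C / (σ * B * √(N : ℝ)) with hμ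
  have hμ0 : 0 < μ := by positivity
  have hδ0 := gaussianDelta_nonneg hμ0 ε
  have hδ1 := gaussianDelta_lt_one ε μ
  refine ⟨Real.log_pos hα, by positivity, ?_, ?_⟩
  · exact (mul_le_of_le_one_left hδ0 hp1).trans_lt hδ1
  rintro D D' ⟨i, k, hk, hi⟩ O hO
  rw [Real.exp_log (by linarith), roundLaw_real_globalAverage ℓ w p hN hσ D hO,
    roundLaw_real_globalAverage ℓ w p hN hσ D' hO, integral_poissonSampling p i k,
    integral_poissonSampling p i k (fun b ↦ Measure.real _ {z | z + batchAverage ℓ w C B D' b ∈ O}),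
    ← integral_const_mul]
  have hconst : p * gaussianDelta ε μ
      = ∫ _, p * gaussianDelta ε μ ∂poissonSampling n p := by simp
  rw [hconst, ← integral_add .of_finite .of_finite]
  refine integral_mono .of_finite .of_finite fun b ↦ ?_
  have hτ : σ ^ 2 / (N : ℝ) = (σ / √(N : ℝ)) ^ 2 := by rw [div_pow, Real.sq_sqrt hN'.le]
  have hτμ : σ / √(N : ℝ) * μ = (N : ℝ)⁻¹ * (B⁻¹ * (2 * C)) := by
    rw [hμ]
    field_simp
    rw [Real.sq_sqrt hN'.le]
  have h0 := batchAverage_setSample_false_congr ℓ w C B hk hi b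
  have h1 := batchAverage_setSample_true ℓ w C B D b i k
  have h1' := batchAverage_setSample_true ℓ w C B D' b i k
  have hg := norm_clip_le hC (gradient (fun w' ↦ ℓ w' (D i k)) w)
  have hg' := norm_clip_le hC (gradient (fun w' ↦ ℓ w' (D' i k)) w)
  have hnorm : ∀ x : EuclideanSpace ℝ (Fin m), ‖x‖ ≤ 2 * C →
      ‖(N : ℝ)⁻¹ • B⁻¹ • x‖ ≤ σ / √(N : ℝ) * μ := by
    intro x hx
    rw [hτμ, norm_smul, norm_smul, norm_inv, norm_inv, Real.norm_of_nonneg hN'.le,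
      Real.norm_of_nonneg hB.le]
    gcongr
  dsimp only
  -- With the differing sample excluded, both datasets have the same average, so a single `F₀`
  -- appears on both sides.
  rw [hτ, ← h0]
  refine subsampling_le hp0.le hp1 he.le ?_ ?_
  · refine multivariateGaussian_real_le hμ0 ε ?_ hO
    rw [h1, h1', ← h0, add_sub_add_left_eq_sub, ← smul_sub, ← smul_sub]
    refine hnorm _ ((norm_sub_le _ _).trans ?_)
    linarith
  -- Dropping the sample moves the average by at most C/(NB), half the replacement bound, so the
  -- same μ serves.
  · refine multivariateGaussian_real_le hμ0 ε ?_ hO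
    rw [h1, sub_add_cancel_left, ← smul_neg, ← smul_neg]
    refine hnorm _ ?_
    rw [norm_neg]
    linarith

end Gradients

end DitheredFL

/-! ### The main theorem -/

theorem mainTheorem1 {N m : ℕ} (hN : 0 < N) (n : Fin N → ℕ) {𝒳 : Type*}
    (ℓ : EuclideanSpace ℝ (Fin m) → 𝒳 → ℝ) (w : EuclideanSpace ℝ (Fin m))
    (C B σ : ℝ) (hC : 0 < C) (hB : 0 < B) (hσ : 0 < σ) (p : unitInterval) (hp : 0 < p) :
    (∀ D : DitheredFL.Datasets n 𝒳,
      HasLaw (fun ω ↦ DitheredFL.globalAverage ℓ w C B σ D ω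
            - DitheredFL.exactAverage ℓ w C B D ω)
          (multivariateGaussian 0 ((σ ^ 2 / (N : ℝ)) • (1 : Matrix (Fin m) (Fin m) ℝ)))
          (DitheredFL.roundLaw n m p σ) ∧
        IndepFun (fun ω ↦ DitheredFL.globalAverage ℓ w C B σ D ω
            - DitheredFL.exactAverage ℓ w C B D ω)
          (fun ω ↦ ω.1) (DitheredFL.roundLaw n m p σ)) ∧
    ∀ ε' : ℝ, 0 < ε' →
      DitheredFL.IsDP (DitheredFL.roundLaw n m p σ) DitheredFL.SampleAdjacent
        (fun (D : DitheredFL.Datasets n 𝒳) ↦ DitheredFL.globalAverage ℓ w C B σ D)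
        (Real.log (1 + (p : ℝ) * (Real.exp ε' - 1)))
        ((p : ℝ) * DitheredFL.stdNormalCDF
            (C / (σ * B * √(N : ℝ)) - ε' * σ * B * √(N : ℝ) / (2 * C))
          - (p : ℝ) * Real.exp ε' * DitheredFL.stdNormalCDF
            (-(C / (σ * B * √(N : ℝ))) - ε' * σ * B * √(N : ℝ) / (2 * C))) := by
  refine ⟨fun D ↦ ?_, fun ε hε ↦ ?_⟩
  · have hm := DitheredFL.measurable_globalAverage_sub_exactAverage (C := C) (B := B) ℓ w σ D
    have hjoint := DitheredFL.map_noise_batches (C := C) (B := B) ℓ w p hN hσ D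
    have hpair := hm.prodMk (measurable_fst (α := DitheredFL.Batches n)
      (β := Fin N → Fin m → ℝ × ℝ))
    -- Both marginals are read off from the joint product law, which then says exactly that noise
    -- and batches are independent.
    have hlaw : (DitheredFL.roundLaw n m p σ).map (fun ω ↦
        DitheredFL.globalAverage ℓ w C B σ D ω - DitheredFL.exactAverage ℓ w C B D ω)
        = multivariateGaussian 0 ((σ ^ 2 / (N : ℝ)) • (1 : Matrix (Fin m) (Fin m) ℝ)) := by
      have := congrArg (Measure.map Prod.fst) hjoint
      rw [Measure.map_map measurable_fst hpair, Measure.map_fst_prod, measure_univ,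
        one_smul] at this
      exact this
    have hbatch : (DitheredFL.roundLaw n m p σ).map (fun ω ↦ ω.1)
        = DitheredFL.poissonSampling n p := by
      have := congrArg (Measure.map Prod.snd) hjoint
      rw [Measure.map_map measurable_snd hpair, Measure.map_snd_prod, measure_univ,
        one_smul] at this
      exact this
    refine ⟨⟨hm.aemeasurable, hlaw⟩, ?_⟩
    rw [indepFun_iff_map_prod_eq_prod_map_map' hm.aemeasurable measurable_fst.aemeasurable
      (by rw [hlaw]; infer_instance) (by rw [hbatch]; infer_instance), hlaw, hbatch]
    exact hjoint
  · have h := DitheredFL.isDP_globalAverage (n := n) ℓ w p hN hC hB hσ hp hε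
    -- For μ = 2C/(σB√N), the quantities μ/2 and ε/μ are the two terms in the arguments of Φ.
    have h1 : 2 * C / (σ * B * √(N : ℝ)) / 2 = C / (σ * B * √(N : ℝ)) := by ring
    have h2 : ε / (2 * C / (σ * B * √(N : ℝ))) = ε * σ * B * √(N : ℝ) / (2 * C) := by
      rw [div_div_eq_mul_div]
      ring
    rwa [DitheredFL.gaussianDelta, h1, h2, mul_sub (p : ℝ) (DitheredFL.stdNormalCDF _),
      ← mul_assoc (p : ℝ)] at h
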